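/- Let $G$ be a (finite-dimensional, real, smooth) Lie group with Lie algebra $\mathfrak g = T_{1}G$ such that the exponential map $\exp\colon \mathfrak g\to G$ is a bijection, and put $\ln=\exp^{-1}$. Let $H=(G,\ast)$ be the commutative group with the same underlying manifold as $G$ and with the product $$g\ast h=\exp(\ln g+\ln h),$$ on which $G$ acts by the group automorphisms $\Phi_g(h)=ghg^{-1}$ (products taken in $G$). Let $\mathcal B\colon H\to G$ be a smooth relative Rota--Baxter operator with respect to this action, i.e. a smooth map with $$\mathcal B(h_1)\,\mathcal B(h_2)=\mathcal B\bigl(h_1\ast \Phi_{\mathcal B(h_1)}(h_2)\bigr)\qquad\text{for all } h_1,h_2\in H.$$ Then the differential at the identity $B=\mathcal B_{*1_G}\colon\mathfrak g\to\mathfrak g$ is a Rota--Baxter operator of weight $0$ on $\mathfrak g$, i.e. $B$ is linear and $$[B(u),B(v)]=B\bigl([B(u),v]+[u,B(v)]\bigr)\qquad\text{for all } u,v\in\mathfrak g.$$ -/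

import Mathlib

open scoped Manifold ContDiff

noncomputable section

namespace RB

/-! ### Rota--Baxter operators -/

/-- A map `B : H → G` is a relative Rota--Baxter operator on the group `H`, with respect to the
action `Φ` of the group `G` on `H` by automorphisms, if `B(h₁) B(h₂) = B(h₁ Φ_{B(h₁)}(h₂))`. -/
def IsRelativeRotaBaxter {H G : Type*} [Group H] [Group G] (Φ : G →* MulAut H) (B : H → G) :
    Prop :=
  ∀ h₁ h₂ : H, B h₁ * B h₂ = B (h₁ * Φ (B h₁) h₂)

/-- A relative Rota--Baxter operator preserves the unit, so that its differential at the unit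
takes values in the tangent space at the unit. -/
theorem IsRelativeRotaBaxter.map_one {H G : Type*} [Group H] [Group G] {Φ : G →* MulAut H}
    {B : H → G} (hB : IsRelativeRotaBaxter Φ B) : B 1 = 1 := by
  have h := hB 1 1
  simpa using h

/-- A linear operator `B` on a Lie algebra `L` is a Rota--Baxter operator of weight `c` if
`[B u, B v] = B ([B u, v] + [u, B v] + c [u, v])`. -/
def IsLieRotaBaxter {R L : Type*} [CommRing R] [LieRing L] [LieAlgebra R L] (c : R)
    (B : L →ₗ[R] L) : Prop :=
  ∀ u v : L, ⁅B u, B v⁆ = B (⁅B u, v⁆ + ⁅u, B v⁆ + c • ⁅u, v⁆)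

/-! ### The exponential map of a Lie group -/

variable {E : Type*} [NormedAddCommGroup E] [NormedSpace ℝ E]
  {G : Type*} [TopologicalSpace G] [ChartedSpace E G] [Group G] [LieGroup 𝓘(ℝ, E) ∞ G]

/-- A smooth Lie group has the regularity under which its Lie algebra is defined. -/
instance instLieGroupMinSmoothness : LieGroup 𝓘(ℝ, E) (minSmoothness ℝ 3) G := by
  rw [minSmoothness_of_isRCLikeNormedField]
  infer_instance

theorem isManifold_one (G : Type*) [TopologicalSpace G] [ChartedSpace E G] [Group G]
    [LieGroup 𝓘(ℝ, E) ∞ G] : IsManifold 𝓘(ℝ, E) 1 G :=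
  have : IsManifold 𝓘(ℝ, E) ∞ G := ContMDiffMul.toIsManifold
  IsManifold.of_le (n := ∞) (by simp)

theorem t2Space (E : Type*) [NormedAddCommGroup E] [NormedSpace ℝ E] (G : Type*)
    [TopologicalSpace G] [ChartedSpace E G] [Group G] [LieGroup 𝓘(ℝ, E) ∞ G] : T2Space G := by
  have : IsTopologicalGroup G := topologicalGroup_of_lieGroup 𝓘(ℝ, E) ∞
  have : T1Space G := ChartedSpace.t1Space E G
  infer_instance

theorem contMDiff_invariant (v : GroupLieAlgebra 𝓘(ℝ, E) G) :
    ContMDiff 𝓘(ℝ, E) 𝓘(ℝ, E).tangent 1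
      (fun g : G ↦ (⟨g, mulInvariantVectorField v g⟩ : TangentBundle 𝓘(ℝ, E) G)) := by
  refine (contMDiff_mulInvariantVectorField v).of_le ?_
  rw [minSmoothness_of_isRCLikeNormedField]
  norm_num

/-- A smooth group homomorphism intertwines invariant vector fields. -/
theorem mfderiv_apply_invariant (φ : G → G) (hφ : ContMDiff 𝓘(ℝ, E) 𝓘(ℝ, E) ∞ φ) (a x : G)
    (φ' : G → G) (hφ' : ContMDiff 𝓘(ℝ, E) 𝓘(ℝ, E) ∞ φ') (h1 : φ' 1 = 1)
    (hmul : ∀ y, φ (x * y) = a * φ' y) (v : GroupLieAlgebra 𝓘(ℝ, E) G) :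
    mfderiv 𝓘(ℝ, E) 𝓘(ℝ, E) φ x (mulInvariantVectorField v x) =
      mulInvariantVectorField (I := 𝓘(ℝ, E)) (G := G)
        (mfderiv 𝓘(ℝ, E) 𝓘(ℝ, E) φ' 1 v : E) a := by
  have hL : ∀ b : G, ContMDiff 𝓘(ℝ, E) 𝓘(ℝ, E) ∞ (b * · : G → G) := fun b ↦ contMDiff_mul_left
  have h0 : (∞ : WithTop ℕ∞) ≠ 0 := by simp
  have e1 := mfderiv_comp_apply_of_eq (x := (1 : G)) (y := x)
    ((hφ x).mdifferentiableAt h0) ((hL x 1).mdifferentiableAt h0) (mul_one x) v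
  have e2 := mfderiv_comp_apply_of_eq (x := (1 : G)) (y := (1 : G))
    ((hL a 1).mdifferentiableAt h0) ((hφ' 1).mdifferentiableAt h0) h1 v
  have e3 : φ ∘ (x * ·) = (a * ·) ∘ φ' := funext hmul
  rw [e3] at e1
  exact e1.symm.trans e2

/-- Left translates of integral curves of an invariant vector field, and images of such curves
under smooth homomorphisms, are integral curves. -/
theorem integralCurveOn_comp (φ : G → G) (hφ : ContMDiff 𝓘(ℝ, E) 𝓘(ℝ, E) ∞ φ)
    (φ' : G → G) (hφ' : ContMDiff 𝓘(ℝ, E) 𝓘(ℝ, E) ∞ φ') (h1 : φ' 1 = 1)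
    (hmul : ∀ x y, φ (x * y) = φ x * φ' y) (v : GroupLieAlgebra 𝓘(ℝ, E) G)
    {γ : ℝ → G} {s : Set ℝ}
    (hγ : IsMIntegralCurveOn γ (mulInvariantVectorField (I := 𝓘(ℝ, E)) v) s) :
    IsMIntegralCurveOn (φ ∘ γ) (mulInvariantVectorField (I := 𝓘(ℝ, E)) (G := G)
        (mfderiv 𝓘(ℝ, E) 𝓘(ℝ, E) φ' 1 v : E)) s := by
  intro t ht
  have h0 : (∞ : WithTop ℕ∞) ≠ 0 := by simp
  have h := ((hφ (γ t)).mdifferentiableAt h0).hasMFDerivAt.comp_hasMFDerivWithinAt t (hγ t ht)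
  have key := mfderiv_apply_invariant φ hφ (φ (γ t)) (γ t) φ' hφ' h1 (hmul _) v
  have e : ∀ (A : E →L[ℝ] E) (a b : E), A a = b →
      A.comp ((1 : ℝ →L[ℝ] ℝ).smulRight a) = (1 : ℝ →L[ℝ] ℝ).smulRight b := by
    rintro A a b rfl
    ext
    simp
  exact (e _ _ _ key) ▸ h

variable [CompleteSpace E]

/-- Left-invariant vector fields on a Lie group are complete. -/
theorem exists_integralCurve (v : GroupLieAlgebra 𝓘(ℝ, E) G) :
    ∃ γ : ℝ → G, γ 0 = 1 ∧
      IsMIntegralCurve γ (mulInvariantVectorField (I := 𝓘(ℝ, E)) v) := by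
  have := isManifold_one (E := E) G
  have := t2Space E G
  obtain ⟨γ, h0, hγ⟩ := exists_isMIntegralCurveAt_of_contMDiffAt_boundaryless (t₀ := 0)
    (x₀ := (1 : G)) (contMDiff_invariant v).contMDiffAt
  obtain ⟨ε, hε, hγ⟩ := isMIntegralCurveAt_iff'.1 hγ
  refine exists_isMIntegralCurve_of_isMIntegralCurveOn (contMDiff_invariant v) hε
    (fun x ↦ ⟨fun t ↦ x * γ t, by simp [h0], ?_⟩) 1
  have key := integralCurveOn_comp (x * ·) contMDiff_mul_left id contMDiff_id rfl
    (fun a b ↦ (mul_assoc x a b).symm ▸ rfl) v hγ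
  simp only [Real.ball_eq_Ioo, zero_sub, zero_add, mfderiv_id] at key
  exact key

/-- The one-parameter subgroup `t ↦ exp (t v)`: the integral curve through `1` of the
left-invariant vector field that `v` generates. -/
def oneParam (v : GroupLieAlgebra 𝓘(ℝ, E) G) : ℝ → G := (exists_integralCurve v).choose

theorem oneParam_zero (v : GroupLieAlgebra 𝓘(ℝ, E) G) : oneParam v 0 = 1 :=
  (exists_integralCurve v).choose_spec.1

theorem oneParam_spec (v : GroupLieAlgebra 𝓘(ℝ, E) G) :
    IsMIntegralCurve (oneParam v) (mulInvariantVectorField (I := 𝓘(ℝ, E)) v) :=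
  (exists_integralCurve v).choose_spec.2

theorem oneParam_unique (v : GroupLieAlgebra 𝓘(ℝ, E) G) {γ : ℝ → G} (h0 : γ 0 = 1)
    (hγ : IsMIntegralCurve γ (mulInvariantVectorField (I := 𝓘(ℝ, E)) v)) : γ = oneParam v := by
  have := isManifold_one (E := E) G
  have := t2Space E G
  exact isMIntegralCurve_Ioo_eq_of_contMDiff_boundaryless (t₀ := 0) (contMDiff_invariant v) hγ
    (oneParam_spec v) (by rw [h0, oneParam_zero])

variable (E G) in
/-- The exponential map `exp : 𝔤 → G`. -/
def lieExp (v : GroupLieAlgebra 𝓘(ℝ, E) G) : G := oneParam v 1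

theorem lieExp_zero : lieExp E G 0 = 1 := by
  have h : (fun _ : ℝ ↦ (1 : G)) = oneParam (0 : GroupLieAlgebra 𝓘(ℝ, E) G) := by
    refine oneParam_unique _ rfl fun t ↦ ?_
    have h1 : mulInvariantVectorField (0 : GroupLieAlgebra 𝓘(ℝ, E) G) (1 : G) = 0 :=
      map_zero (mfderiv 𝓘(ℝ, E) 𝓘(ℝ, E) ((1 : G) * ·) (1 : G))
    have e : (1 : ℝ →L[ℝ] ℝ).smulRight (0 : E) = 0 := by
      ext
      simp
    rw [h1]
    exact e ▸ hasMFDerivAt_const (1 : G) t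
  exact (congrFun h 1).symm

variable (E) in
/-- The adjoint action of `G` on its Lie algebra. Its value lies in the tangent space at
`g * 1 * g⁻¹ = 1`. -/
def lieAd (g : G) : GroupLieAlgebra 𝓘(ℝ, E) G →L[ℝ] GroupLieAlgebra 𝓘(ℝ, E) G :=
  mfderiv 𝓘(ℝ, E) 𝓘(ℝ, E) (fun x : G ↦ g * x * g⁻¹) 1

theorem lieExp_lieAd (g : G) (v : GroupLieAlgebra 𝓘(ℝ, E) G) :
    lieExp E G (lieAd E g v) = g * lieExp E G v * g⁻¹ := by
  have hc : ContMDiff 𝓘(ℝ, E) 𝓘(ℝ, E) ∞ (fun x : G ↦ g * x * g⁻¹) :=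
    (contMDiff_mul_right (a := g⁻¹)).comp (contMDiff_mul_left (a := g))
  have key := integralCurveOn_comp (s := Set.univ) _ hc _ hc (by simp)
    (fun x y ↦ by group) v ((oneParam_spec v).isMIntegralCurveOn _)
  have h := oneParam_unique (lieAd E g v) (γ := (fun x : G ↦ g * x * g⁻¹) ∘ oneParam v)
    (by simp [oneParam_zero]) (isMIntegralCurve_iff_isMIntegralCurveOn.2 key)
  exact (congrFun h 1).symm

/-! ### The commutative group with product `exp (ln g + ln h)` -/

/-- The manifold `G`, to be equipped with the product `g ∗ h = exp (ln g + ln h)`. -/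
def ExpGroup (_hexp : Function.Bijective (lieExp E G)) : Type _ := G

namespace ExpGroup

variable {hexp : Function.Bijective (lieExp E G)}

instance : TopologicalSpace (ExpGroup hexp) := inferInstanceAs (TopologicalSpace G)

instance : ChartedSpace E (ExpGroup hexp) := inferInstanceAs (ChartedSpace E G)

/-- The identity map from `G` to the manifold `G` with the new product. -/
def of (hexp : Function.Bijective (lieExp E G)) : G ≃ ExpGroup hexp := Equiv.refl G

/-- The exponential map as a bijection from `𝔤` onto `H`; its inverse is `ln`. -/
def exp (hexp : Function.Bijective (lieExp E G)) :
    GroupLieAlgebra 𝓘(ℝ, E) G ≃ ExpGroup hexp :=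
  (Equiv.ofBijective (lieExp E G) hexp).trans (of hexp)

/-- The logarithm `ln = exp⁻¹`. -/
def ln (g : ExpGroup hexp) : GroupLieAlgebra 𝓘(ℝ, E) G := (exp hexp).symm g

theorem ln_exp (v : GroupLieAlgebra 𝓘(ℝ, E) G) : ln (exp hexp v) = v :=
  (exp hexp).symm_apply_apply v

theorem exp_ln (g : ExpGroup hexp) : exp hexp (ln g) = g := (exp hexp).apply_symm_apply g

theorem exp_zero : exp hexp 0 = of hexp 1 := congrArg (of hexp) lieExp_zero

theorem ln_one : ln (of hexp 1) = 0 := by rw [← exp_zero, ln_exp]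

/-- The product is `g ∗ h = exp (ln g + ln h)`; the unit is the unit of `G`. -/
instance : CommGroup (ExpGroup hexp) where
  mul g h := exp hexp (ln g + ln h)
  one := of hexp 1
  inv g := exp hexp (-ln g)
  mul_assoc a b c := by
    change exp hexp (ln (exp hexp (ln a + ln b)) + ln c) =
      exp hexp (ln a + ln (exp hexp (ln b + ln c)))
    rw [ln_exp, ln_exp, add_assoc]
  one_mul a := by
    change exp hexp (ln (of hexp 1) + ln a) = a
    rw [ln_one, zero_add, exp_ln]
  mul_one a := by
    change exp hexp (ln a + ln (of hexp 1)) = a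
    rw [ln_one, add_zero, exp_ln]
  inv_mul_cancel a := by
    change exp hexp (ln (exp hexp (-ln a)) + ln a) = of hexp 1
    rw [ln_exp, neg_add_cancel, exp_zero]
  mul_comm a b := by
    change exp hexp (ln a + ln b) = exp hexp (ln b + ln a)
    rw [add_comm]

theorem mul_def (g h : ExpGroup hexp) : g * h = exp hexp (ln g + ln h) := rfl

/-- Conjugation by `g` on the underlying set of `H`. -/
def conj (hexp : Function.Bijective (lieExp E G)) (g : G) (h : ExpGroup hexp) : ExpGroup hexp :=
  of hexp (g * (of hexp).symm h * g⁻¹)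

theorem conj_exp (g : G) (v : GroupLieAlgebra 𝓘(ℝ, E) G) :
    conj hexp g (exp hexp v) = exp hexp (lieAd E g v) :=
  congrArg (of hexp) (lieExp_lieAd g v).symm

theorem conj_mul (g : G) (a b : ExpGroup hexp) :
    conj hexp g (a * b) = conj hexp g a * conj hexp g b := by
  rw [← exp_ln a, ← exp_ln b, conj_exp, conj_exp, mul_def, mul_def]
  simp only [ln_exp, conj_exp, map_add]

/-- The adjoint action of `G` on `H`: `g` acts by `h ↦ g h g⁻¹` (products taken in `G`). -/
def Ad (hexp : Function.Bijective (lieExp E G)) : G →* MulAut (ExpGroup hexp) where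
  toFun g :=
    { toFun := conj hexp g
      invFun := conj hexp g⁻¹
      left_inv := fun h ↦ by
        apply (of hexp).symm.injective
        simp [conj, mul_assoc]
      right_inv := fun h ↦ by
        apply (of hexp).symm.injective
        simp [conj, mul_assoc]
      map_mul' := conj_mul g }
  map_one' := by
    ext h
    simp [conj]
  map_mul' a b := by
    ext h
    simp [conj, mul_assoc]

end ExpGroup

/-- The differential at the unit `𝓑_{*1} : 𝔤 → 𝔤` of a map `𝓑 : H → G` with `𝓑 1 = 1`. The
manifold underlying `H` is `G` and its unit is `1`, so `T₁H = T₁G = 𝔤`. -/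
def differentialAtOne {hexp : Function.Bijective (lieExp E G)} (B : ExpGroup hexp → G) :
    GroupLieAlgebra 𝓘(ℝ, E) G →ₗ[ℝ] GroupLieAlgebra 𝓘(ℝ, E) G :=
  (mfderiv 𝓘(ℝ, E) 𝓘(ℝ, E) B (1 : ExpGroup hexp)).toLinearMap

end RB

end

/-! Put `f = B ∘ exp : 𝔤 → G` and let `D` be the differential of `B` at the unit. Since `exp`
intertwines `Ad` with conjugation, the Rota--Baxter relation becomes `f(u) f(v) = f(u + Ad_{f(u)}
v)`. Taking `v = t Ad_{f(x)}⁻¹ w` gives `f(x + t w) = f(x) f(t Ad_{f(x)}⁻¹ w)`, so the derivative of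
`f` at `x` in the direction `w` is the left translate by `f(x)` of `D (Ad_{f(x)}⁻¹ w)`.

In a chart at the unit, let `L_y` and `R_y` be the differentials at the unit of the left and right
translations. Then `Ad⁻¹` reads `L_y⁻¹ R_y`, and `f` solves the total differential equation `df_x =
K(f(x))` with `K(y) = L_y D L_y⁻¹ R_y` (`rotaBaxterDeriv`, `hasLineDerivAt_compExp`). Its
integrability condition at `0`, the symmetry of the second derivative of `f`, is `dK(D a) b = dK(D
b) a`. The formula for `dK` (`fderiv_rotaBaxterDeriv_apply`) and `[u, v] = dL(u) v - dL(v) u`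
(`bracket_eq_chartLeft`) turn it into the Rota--Baxter identity.

Smoothness of `exp` is never invoked: only its rays, the one-parameter subgroups, enter. Hence the
equation first holds for line derivatives alone. A speed bound keeps `f` in the chart near `0`, the
mean value inequality makes it Lipschitz there, and continuity of `K` upgrades line derivatives to
Fréchet derivatives (`eventually_hasFDerivAt_compExp`). -/

noncomputable section

namespace RB

open Set Filter Topology

/-! ### Calculus: line derivatives and curves in a chart -/

/-- A map with line derivatives bounded by `C` on a convex set is `C`-Lipschitz there. -/
theorem norm_sub_le_of_hasLineDerivAt {E F : Type*} [NormedAddCommGroup E] [NormedSpace ℝ E]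
    [NormedAddCommGroup F] [NormedSpace ℝ F] {f : E → F} {f' : E → E → F} {s : Set E}
    (hs : Convex ℝ s) (hf : ∀ x ∈ s, ∀ w, HasLineDerivAt ℝ f (f' x w) x w) {C : ℝ}
    (hC : ∀ x ∈ s, ∀ w, ‖f' x w‖ ≤ C * ‖w‖) {x y : E} (hx : x ∈ s) (hy : y ∈ s) :
    ‖f y - f x‖ ≤ C * ‖y - x‖ := by
  have hmem : ∀ t ∈ Icc (0 : ℝ) 1, x + t • (y - x) ∈ s := fun t ht ↦
    hs.add_smul_sub_mem hx hy ht
  have h := norm_image_sub_le_of_norm_deriv_le_segment_01'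
    (f := fun t : ℝ ↦ f (x + t • (y - x))) (f' := fun t ↦ f' (x + t • (y - x)) (y - x))
    (C := C * ‖y - x‖) (fun t ht ↦ ?_)
    (fun t ht ↦ hC _ (hmem t (Ico_subset_Icc_self ht)) _)
  · simpa using h
  -- The base point is written `t - t` instead of `0` to match the translation lemma
  -- `comp_sub_const`.
  · have h0 : HasDerivAt (fun r : ℝ ↦ f (x + t • (y - x) + r • (y - x)))
        (f' (x + t • (y - x)) (y - x)) (t - t) := by
      rw [sub_self]
      exact hf _ (hmem t ht) (y - x)
    have h1 := h0.comp_sub_const t t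
    refine (h1.congr_of_eventuallyEq (.of_forall fun r ↦ ?_)).hasDerivWithinAt
    simp only
    congr 1
    module

/-- A map whose line derivatives near `x` are given by linear maps depending continuously on the
point is differentiable at `x`. -/
theorem hasFDerivAt_of_hasLineDerivAt {E F : Type*} [NormedAddCommGroup E] [NormedSpace ℝ E]
    [NormedAddCommGroup F] [NormedSpace ℝ F] {f : E → F} {f' : E → E →L[ℝ] F} {x : E}
    (hf : ∀ᶠ y in 𝓝 x, ∀ w, HasLineDerivAt ℝ f (f' y w) y w) (hc : ContinuousAt f' x) :
    HasFDerivAt f (f' x) x := by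
  rw [hasFDerivAt_iff_isLittleO, Asymptotics.isLittleO_iff]
  intro ε hε
  have hclose : ∀ᶠ y in 𝓝 x, ‖f' y - f' x‖ < ε := by
    simpa [dist_eq_norm] using hc.eventually (Metric.ball_mem_nhds _ hε)
  obtain ⟨δ, hδ, hball⟩ := Metric.eventually_nhds_iff_ball.1 (hf.and hclose)
  filter_upwards [Metric.ball_mem_nhds x hδ] with y hy
  -- The mean value inequality applied to `f - f' x`, whose line derivatives on the ball are at most
  -- `ε ‖w‖`.
  have h := norm_sub_le_of_hasLineDerivAt (f := fun z ↦ f z - f' x z)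
    (f' := fun z w ↦ (f' z - f' x) w) (convex_ball x δ) (fun z hz w ↦ ?_) (C := ε)
    (fun z hz w ↦ ContinuousLinearMap.le_of_opNorm_le _ (hball z hz).2.le w)
    (Metric.mem_ball_self hδ) hy
  · have e : f y - f' x y - (f x - f' x x) = f y - f x - f' x (y - x) := by
      rw [map_sub]
      abel
    rwa [e] at h
  · exact ((hball z hz).1 w).sub ((f' x).hasFDerivAt.hasLineDerivAt w)

/-- A curve that starts at the centre of a chart ball of radius `r`, and has speed at most `C < r`
as long as it stays in that ball, does not leave it. -/
theorem mem_source_of_speed_le {E M : Type*} [NormedAddCommGroup E] [NormedSpace ℝ E]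
    [ProperSpace E] [TopologicalSpace M] [T2Space M] (c : OpenPartialHomeomorph M E) {p : M}
    (hp : p ∈ c.source) {r : ℝ} (hr0 : 0 < r) (hr : Metric.ball (c p) r ⊆ c.target) {γ : ℝ → M}
    (hγ : Continuous γ) (h0 : γ 0 = p) {γ' : ℝ → E} {C : ℝ} (hCr : C < r)
    (hd : ∀ t, γ t ∈ c.source → c (γ t) ∈ Metric.ball (c p) r →
      HasDerivAt (c ∘ γ) (γ' t) t ∧ ‖γ' t‖ ≤ C) {t : ℝ} (ht : t ∈ Icc (0 : ℝ) 1) :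
    γ t ∈ c.source ∧ c (γ t) ∈ Metric.ball (c p) r := by
  set U : Set M := c.source ∩ c ⁻¹' Metric.ball (c p) r with hU
  set K : Set M := c.symm '' Metric.closedBall (c p) C with hK
  have hCr' : Metric.closedBall (c p) C ⊆ Metric.ball (c p) r :=
    Metric.closedBall_subset_ball hCr
  have hUo : IsOpen U := c.isOpen_inter_preimage Metric.isOpen_ball
  have hKc : IsClosed K := ((isCompact_closedBall _ _).image_of_continuousOn
    (c.continuousOn_symm.mono (hCr'.trans hr))).isClosed
  have hKU : K ⊆ U := by
    rintro _ ⟨y, hy, rfl⟩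
    have hyt := hr (hCr' hy)
    exact ⟨c.map_target hyt, by simpa only [mem_preimage, c.right_inv hyt] using hCr' hy⟩
  -- Staying in the open set `U` up to time `t ≤ 1` already forces the smaller closed set `K`, since
  -- the distance travelled is at most `C t ≤ C`.
  have step : ∀ t ∈ Icc (0 : ℝ) 1, (∀ s ∈ Icc 0 t, γ s ∈ U) → γ t ∈ K := by
    intro t ht h
    refine ⟨c (γ t), ?_, c.left_inv (h t ⟨ht.1, le_rfl⟩).1⟩
    have h1 := norm_image_sub_le_of_norm_deriv_le_segment' (f := c ∘ γ) (C := C)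
      (fun s hs ↦ (hd s (h s hs).1 (h s hs).2).1.hasDerivWithinAt)
      (fun s hs ↦ (hd s (h s (Ico_subset_Icc_self hs)).1 (h s (Ico_subset_Icc_self hs)).2).2) t
      ⟨ht.1, le_rfl⟩
    have hC0 : 0 ≤ C := (norm_nonneg _).trans (hd t (h t ⟨ht.1, le_rfl⟩).1
      (h t ⟨ht.1, le_rfl⟩).2).2
    rw [mem_closedBall_iff_norm]
    simp only [Function.comp_apply, h0] at h1
    nlinarith [ht.2]
  by_contra hbad
  have hcomp : IsCompact (Icc (0 : ℝ) 1 ∩ γ ⁻¹' Uᶜ) :=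
    isCompact_Icc.inter_right (hUo.isClosed_compl.preimage hγ)
  -- `T` is the first exit time from `U`. Before `T` the curve lies in `K`, so by closedness it is
  -- in `K ⊆ U` at `T` as well, a contradiction.
  obtain ⟨T, ⟨hT, hTU⟩, hmin⟩ := hcomp.exists_isLeast ⟨t, ht, hbad⟩
  have hlt : ∀ s ∈ Ico 0 T, γ s ∈ U := fun s hs ↦ by
    by_contra hsU
    exact (hmin ⟨⟨hs.1, hs.2.le.trans hT.2⟩, hsU⟩).not_gt hs.2
  have hltK : ∀ s ∈ Ico 0 T, γ s ∈ K := fun s hs ↦ step s ⟨hs.1, hs.2.le.trans hT.2⟩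
    fun s' hs' ↦ hlt s' ⟨hs'.1, hs'.2.trans_lt hs.2⟩
  have hT0 : 0 ≠ T := by
    rintro rfl
    refine hTU ⟨h0 ▸ hp, ?_⟩
    rw [mem_preimage, h0]
    exact Metric.mem_ball_self hr0
  have hcl : T ∈ closure (Ico 0 T) := by
    rw [closure_Ico hT0]
    exact right_mem_Icc.2 hT.1
  exact hTU (hKU (closure_minimal (fun s hs ↦ hltK s hs) (hKc.preimage hγ) hcl))

/-! ### The group law in a chart at the unit -/

section ChartGroupLaw

variable {E : Type*} [NormedAddCommGroup E]
  {G : Type*} [TopologicalSpace G] [ChartedSpace E G] [Group G]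

variable (E G) in
/-- The coordinates of the unit in the preferred chart at the unit. -/
def chartOne : E := chartAt E (1 : G) 1

theorem chartOne_mem_target : chartOne E G ∈ (chartAt E (1 : G)).target :=
  mem_chart_target E (1 : G)

theorem chartAt_symm_chartOne : (chartAt E (1 : G)).symm (chartOne E G) = 1 :=
  (chartAt E (1 : G)).left_inv (mem_chart_source E (1 : G))

variable (E G) in
/-- The group law in the preferred chart at the unit. -/
def chartMul (p : E × E) : E :=
  chartAt E (1 : G) ((chartAt E (1 : G)).symm p.1 * (chartAt E (1 : G)).symm p.2)

variable [NormedSpace ℝ E]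

variable (E G) in
/-- The differential at the unit of the left translation by the point with coordinates `y`. -/
def chartLeft (y : E) : E →L[ℝ] E := fderiv ℝ (fun z ↦ chartMul E G (y, z)) (chartOne E G)

variable (E G) in
/-- The differential at the unit of the right translation by the point with coordinates `y`. -/
def chartRight (y : E) : E →L[ℝ] E := fderiv ℝ (fun z ↦ chartMul E G (z, y)) (chartOne E G)

theorem chartLeft_chartOne : chartLeft E G (chartOne E G) = ContinuousLinearMap.id ℝ E := by
  refine HasFDerivAt.fderiv ((hasFDerivAt_id _).congr_of_eventuallyEq ?_)
  filter_upwards [(chartAt E (1 : G)).open_target.mem_nhds chartOne_mem_target] with y hy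
  simp only [chartMul, chartAt_symm_chartOne, one_mul, id, (chartAt E (1 : G)).right_inv hy]

theorem chartRight_chartOne : chartRight E G (chartOne E G) = ContinuousLinearMap.id ℝ E := by
  refine HasFDerivAt.fderiv ((hasFDerivAt_id _).congr_of_eventuallyEq ?_)
  filter_upwards [(chartAt E (1 : G)).open_target.mem_nhds chartOne_mem_target] with y hy
  simp only [chartMul, chartAt_symm_chartOne, mul_one, id, (chartAt E (1 : G)).right_inv hy]

variable [LieGroup 𝓘(ℝ, E) ∞ G]

/-- A smooth Lie group is a smooth manifold. -/
theorem isManifold_infty (E : Type*) [NormedAddCommGroup E] [NormedSpace ℝ E] (G : Type*)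
    [TopologicalSpace G] [ChartedSpace E G] [Group G] [LieGroup 𝓘(ℝ, E) ∞ G] :
    IsManifold 𝓘(ℝ, E) ∞ G :=
  ContMDiffMul.toIsManifold

theorem contMDiffAt_chartAt_symm {x : E} (hx : x ∈ (chartAt E (1 : G)).target) :
    ContMDiffAt 𝓘(ℝ, E) 𝓘(ℝ, E) ∞ (chartAt E (1 : G)).symm x := by
  have := isManifold_infty E G
  exact (contMDiffOn_chart_symm x hx).contMDiffAt
    ((chartAt E (1 : G)).open_target.mem_nhds hx)

theorem contMDiffAt_chartAt_one {g : G} (hg : g ∈ (chartAt E (1 : G)).source) :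
    ContMDiffAt 𝓘(ℝ, E) 𝓘(ℝ, E) ∞ (chartAt E (1 : G)) g := by
  have := isManifold_infty E G
  exact (contMDiffOn_chart g hg).contMDiffAt ((chartAt E (1 : G)).open_source.mem_nhds hg)

theorem contDiffAt_chartMul {x y : E} (hx : x ∈ (chartAt E (1 : G)).target)
    (hy : y ∈ (chartAt E (1 : G)).target)
    (hxy : (chartAt E (1 : G)).symm x * (chartAt E (1 : G)).symm y ∈ (chartAt E (1 : G)).source) :
    ContDiffAt ℝ ∞ (chartMul E G) (x, y) := by
  have h1 : ContMDiffAt 𝓘(ℝ, E × E) 𝓘(ℝ, E) ∞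
      (fun p : E × E ↦ (chartAt E (1 : G)).symm p.1) (x, y) :=
    ContMDiffAt.comp (x, y) (contMDiffAt_chartAt_symm hx) contDiff_fst.contMDiff.contMDiffAt
  have h2 : ContMDiffAt 𝓘(ℝ, E × E) 𝓘(ℝ, E) ∞
      (fun p : E × E ↦ (chartAt E (1 : G)).symm p.2) (x, y) :=
    ContMDiffAt.comp (x, y) (contMDiffAt_chartAt_symm hy) contDiff_snd.contMDiff.contMDiffAt
  exact (ContMDiffAt.comp (x, y) (contMDiffAt_chartAt_one hxy) (h1.mul h2)).contDiffAt

theorem contDiffAt_chartMul_left {x : E} (hx : x ∈ (chartAt E (1 : G)).target) :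
    ContDiffAt ℝ ∞ (chartMul E G) (x, chartOne E G) :=
  contDiffAt_chartMul hx chartOne_mem_target (by
    rw [chartAt_symm_chartOne, mul_one]
    exact (chartAt E (1 : G)).map_target hx)

theorem contDiffAt_chartMul_right {x : E} (hx : x ∈ (chartAt E (1 : G)).target) :
    ContDiffAt ℝ ∞ (chartMul E G) (chartOne E G, x) :=
  contDiffAt_chartMul chartOne_mem_target hx (by
    rw [chartAt_symm_chartOne, one_mul]
    exact (chartAt E (1 : G)).map_target hx)

theorem hasFDerivAt_chartMul_left {x : E} (hx : x ∈ (chartAt E (1 : G)).target) :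
    HasFDerivAt (fun z ↦ chartMul E G (x, z)) (chartLeft E G x) (chartOne E G) := by
  have h := ((contDiffAt_chartMul_left hx).differentiableAt (by simp)).hasFDerivAt.comp
    (chartOne E G) (hasFDerivAt_prodMk_right x (chartOne E G))
  exact h.differentiableAt.hasFDerivAt

theorem hasFDerivAt_chartMul_right {x : E} (hx : x ∈ (chartAt E (1 : G)).target) :
    HasFDerivAt (fun z ↦ chartMul E G (z, x)) (chartRight E G x) (chartOne E G) := by
  have h := HasFDerivAt.comp (f := fun z ↦ (z, x)) (chartOne E G)
    ((contDiffAt_chartMul_right hx).differentiableAt (by simp)).hasFDerivAt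
    (hasFDerivAt_prodMk_left (chartOne E G) x)
  exact h.differentiableAt.hasFDerivAt

/-- Expressing the partial derivative through the full derivative of the group law exhibits its
smooth dependence on the base point. -/
theorem chartLeft_eq {x : E} (hx : x ∈ (chartAt E (1 : G)).target) :
    chartLeft E G x = (fderiv ℝ (chartMul E G) (x, chartOne E G)).comp
      (ContinuousLinearMap.inr ℝ E E) :=
  (((contDiffAt_chartMul_left hx).differentiableAt (by simp)).hasFDerivAt.comp
    (chartOne E G) (hasFDerivAt_prodMk_right x (chartOne E G))).fderiv

theorem chartRight_eq {x : E} (hx : x ∈ (chartAt E (1 : G)).target) :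
    chartRight E G x = (fderiv ℝ (chartMul E G) (chartOne E G, x)).comp
      (ContinuousLinearMap.inl ℝ E E) :=
  (HasFDerivAt.comp (f := fun z ↦ (z, x)) (chartOne E G)
    ((contDiffAt_chartMul_right hx).differentiableAt (by simp)).hasFDerivAt
    (hasFDerivAt_prodMk_left (chartOne E G) x)).fderiv

theorem contDiffAt_chartLeft {x : E} (hx : x ∈ (chartAt E (1 : G)).target) :
    ContDiffAt ℝ ∞ (chartLeft E G) x := by
  have h1 : ContDiffAt ℝ ∞ (fun y ↦ fderiv ℝ (chartMul E G) (y, chartOne E G)) x :=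
    ((contDiffAt_chartMul_left hx).fderiv_right (m := ∞) (by simp)).comp x
      (contDiffAt_id.prodMk contDiffAt_const)
  refine (h1.clm_comp
    (contDiffAt_const (c := ContinuousLinearMap.inr ℝ E E))).congr_of_eventuallyEq ?_
  filter_upwards [(chartAt E (1 : G)).open_target.mem_nhds hx] with y hy using chartLeft_eq hy

theorem contDiffAt_chartRight {x : E} (hx : x ∈ (chartAt E (1 : G)).target) :
    ContDiffAt ℝ ∞ (chartRight E G) x := by
  have h1 : ContDiffAt ℝ ∞ (fun y ↦ fderiv ℝ (chartMul E G) (chartOne E G, y)) x :=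
    ((contDiffAt_chartMul_right hx).fderiv_right (m := ∞) (by simp)).comp x
      (contDiffAt_const.prodMk contDiffAt_id)
  refine (h1.clm_comp
    (contDiffAt_const (c := ContinuousLinearMap.inl ℝ E E))).congr_of_eventuallyEq ?_
  filter_upwards [(chartAt E (1 : G)).open_target.mem_nhds hx] with y hy using chartRight_eq hy

/-- The mixed second derivatives of the group law agree. -/
theorem fderiv_chartRight_apply (u v : E) :
    fderiv ℝ (chartRight E G) (chartOne E G) u v = fderiv ℝ (chartLeft E G) (chartOne E G) v u := by
  have hm := contDiffAt_chartMul_left (E := E) (G := G) chartOne_mem_target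
  have hd : HasFDerivAt (fderiv ℝ (chartMul E G)) (fderiv ℝ (fderiv ℝ (chartMul E G))
      (chartOne E G, chartOne E G)) (chartOne E G, chartOne E G) :=
    ((hm.fderiv_right (m := ∞) (by simp)).differentiableAt (by simp)).hasFDerivAt
  have hsymm : IsSymmSndFDerivAt ℝ (chartMul E G) (chartOne E G, chartOne E G) :=
    hm.isSymmSndFDerivAt (by
    rw [minSmoothness_of_isRCLikeNormedField]
    exact WithTop.coe_le_coe.2 le_top)
  have hT := (chartAt E (1 : G)).open_target.mem_nhds (chartOne_mem_target (E := E) (G := G))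
  have hL := ((HasFDerivAt.comp (f := fun z ↦ (z, chartOne E G)) (chartOne E G) hd
    (hasFDerivAt_prodMk_left (chartOne E G) (chartOne E G))).clm_comp
    (hasFDerivAt_const (ContinuousLinearMap.inr ℝ E E) _)
    ).congr_of_eventuallyEq (f₁ := chartLeft E G)
    (by filter_upwards [hT] with y hy using chartLeft_eq hy)
  have hR := ((hd.comp (chartOne E G) (hasFDerivAt_prodMk_right (chartOne E G)
    (chartOne E G))).clm_comp (hasFDerivAt_const (ContinuousLinearMap.inl ℝ E E) _)
    ).congr_of_eventuallyEq (f₁ := chartRight E G)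
    (by filter_upwards [hT] with y hy using chartRight_eq hy)
  rw [hL.fderiv, hR.fderiv]
  -- Both sides are the mixed entry of the symmetric second derivative: one vector varies the second
  -- factor, the other the first.
  simpa using hsymm (0, u) (v, 0)

end ChartGroupLaw

/-! ### Adjoint action, invariant fields and bracket in the chart -/

section LieGroupInChart

variable {E : Type*} [NormedAddCommGroup E] [NormedSpace ℝ E]
  {G : Type*} [TopologicalSpace G] [ChartedSpace E G] [Group G]

/-- A map between Lie groups that preserves the unit, read in charts. -/
theorem hasFDerivAt_chart_of_map_one {f : G → G} (h1 : f 1 = 1)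
    (hf : MDifferentiableAt 𝓘(ℝ, E) 𝓘(ℝ, E) f 1) :
    HasFDerivAt (fun y ↦ chartAt E (1 : G) (f ((chartAt E (1 : G)).symm y)))
      (mfderiv 𝓘(ℝ, E) 𝓘(ℝ, E) f 1 : E →L[ℝ] E) (chartOne E G) := by
  have h := hf.hasMFDerivAt.2
  simp only [writtenInExtChartAt, h1, mfld_simps] at h
  exact hasFDerivWithinAt_univ.1 h

/-- The velocity at `0` of a curve through the unit, read in the chart. -/
theorem hasDerivAt_chart_of_zero {γ : ℝ → G} (h0 : γ 0 = 1) {d : ℝ →L[ℝ] E}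
    (h : HasMFDerivAt 𝓘(ℝ, ℝ) 𝓘(ℝ, E) γ 0 d) :
    HasDerivAt (chartAt E (1 : G) ∘ γ) (d 1) 0 := by
  have h := h.2
  simp only [writtenInExtChartAt, h0, mfld_simps] at h
  have h' : HasFDerivAt (chartAt E (1 : G) ∘ γ) d 0 := hasFDerivWithinAt_univ.1 h
  exact h'.hasDerivAt

theorem mulInvariantVectorField_one (v : GroupLieAlgebra 𝓘(ℝ, E) G) :
    (mulInvariantVectorField v (1 : G) : E) = v := by
  have e : ((1 : G) * ·) = (id : G → G) := funext one_mul
  change (mfderiv 𝓘(ℝ, E) 𝓘(ℝ, E) ((1 : G) * ·) 1 v : E) = v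
  rw [e, mfderiv_id]
  rfl

variable [LieGroup 𝓘(ℝ, E) ∞ G]

/-- Left translation is conjugation followed by right translation. -/
theorem chartRight_lieAd {x : E} (hx : x ∈ (chartAt E (1 : G)).target) (v : E) :
    chartRight E G x (lieAd E ((chartAt E (1 : G)).symm x) v) = chartLeft E G x v := by
  set g := (chartAt E (1 : G)).symm x with hg
  have hc : ContMDiff 𝓘(ℝ, E) 𝓘(ℝ, E) ∞ (fun x : G ↦ g * x * g⁻¹) :=
    (contMDiff_mul_right (a := g⁻¹)).comp (contMDiff_mul_left (a := g))
  have h1 := hasFDerivAt_chart_of_map_one (E := E) (f := fun x : G ↦ g * x * g⁻¹) (by simp)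
    (hc.contMDiffAt.mdifferentiableAt (by simp))
  have h2 := HasFDerivAt.comp (chartOne E G) (g := fun z ↦ chartMul E G (z, x))
    (f := fun y ↦ chartAt E (1 : G) (g * (chartAt E (1 : G)).symm y * g⁻¹))
    (g' := chartRight E G x) (by
      simp only [chartAt_symm_chartOne, mul_one, mul_inv_cancel]
      exact hasFDerivAt_chartMul_right hx) h1
  have hcont : ContinuousAt (fun y ↦ g * (chartAt E (1 : G)).symm y * g⁻¹) (chartOne E G) :=
    hc.continuous.continuousAt.comp
      ((chartAt E (1 : G)).continuousAt_symm chartOne_mem_target)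
  have hs : ∀ᶠ y in 𝓝 (chartOne E G),
      g * (chartAt E (1 : G)).symm y * g⁻¹ ∈ (chartAt E (1 : G)).source := by
    refine hcont ((chartAt E (1 : G)).open_source.mem_nhds ?_)
    simp [chartAt_symm_chartOne]
  -- Near the unit `(g y g⁻¹) g = g y`, so the composite differentiated in `h2` is also the left
  -- translation; uniqueness of derivatives concludes.
  have h3 := (hasFDerivAt_chartMul_left hx).congr_of_eventuallyEq (f₁ := fun y ↦
      chartMul E G (chartAt E (1 : G) (g * (chartAt E (1 : G)).symm y * g⁻¹), x)) (by
    filter_upwards [hs] with y hy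
    simp only [chartMul, (chartAt E (1 : G)).left_inv hy, ← hg, inv_mul_cancel_right])
  exact DFunLike.congr_fun (h2.unique h3) v

/-- Invariant vector fields, read in the chart. -/
theorem mpullbackWithin_mulInvariantVectorField {x : E} (hx : x ∈ (chartAt E (1 : G)).target)
    (v : GroupLieAlgebra 𝓘(ℝ, E) G) :
    VectorField.mpullbackWithin 𝓘(ℝ, E) 𝓘(ℝ, E) (extChartAt 𝓘(ℝ, E) (1:G)).symm
      (mulInvariantVectorField v) (range 𝓘(ℝ, E)) x = chartLeft E G x v := by
  have := isManifold_one (E := E) G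
  have hx' : x ∈ (extChartAt 𝓘(ℝ, E) (1:G)).target := by simpa using hx
  rw [VectorField.mpullbackWithin_apply]
  have e1 := mfderivWithin_extChartAt_symm_comp_mfderiv_extChartAt hx'
  have e2 := mfderiv_extChartAt_comp_mfderivWithin_extChartAt_symm hx'
  rw [ContinuousLinearMap.inverse_eq e1 e2]
  set g := (chartAt E (1 : G)).symm x with hg
  have hgs : g ∈ (chartAt E (1 : G)).source := (chartAt E (1 : G)).map_target hx
  have hL : MDifferentiableAt 𝓘(ℝ, E) 𝓘(ℝ, E) (g * · : G → G) 1 :=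
    (contMDiff_mul_left (n := ∞) 1).mdifferentiableAt (by simp)
  have hC := (contMDiffAt_chartAt_one hgs).mdifferentiableAt (by simp)
  have e := mfderiv_comp_apply_of_eq (x := (1 : G)) (y := g) hC hL (mul_one g) v
  have hm := (hC.comp_of_eq (x := (1 : G)) (y := g) hL (mul_one g)).hasMFDerivAt.2
  simp only [writtenInExtChartAt, mfld_simps] at hm
  -- Stated for an arbitrary `A` on `E`, since the manifold derivative acts between tangent spaces
  -- that are `E` only by unfolding.
  have key : ∀ A : E →L[ℝ] E, HasFDerivAt (fun z ↦ chartMul E G (x, z)) A (chartOne E G) →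
      A v = chartLeft E G x v := fun A hA ↦ by rw [chartLeft, hA.fderiv]
  exact e.symm.trans (key _ (hasFDerivWithinAt_univ.1 hm))

/-- The Lie bracket in terms of the derivative of the left translations, read in the chart. -/
theorem bracket_eq_chartLeft (u v : GroupLieAlgebra 𝓘(ℝ, E) G) :
    (⁅u, v⁆ : GroupLieAlgebra 𝓘(ℝ, E) G) =
      (fderiv ℝ (chartLeft E G) (chartOne E G) u v -
        fderiv ℝ (chartLeft E G) (chartOne E G) v u : E) := by
  have := isManifold_one (E := E) G
  rw [GroupLieAlgebra.bracket_def, VectorField.mlieBracket, VectorField.mlieBracketWithin_apply,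
    mfderiv_extChartAt_self]
  have hev : ∀ w : GroupLieAlgebra 𝓘(ℝ, E) G,
      VectorField.mpullbackWithin 𝓘(ℝ, E) 𝓘(ℝ, E) (extChartAt 𝓘(ℝ, E) (1:G)).symm
      (mulInvariantVectorField w) (range 𝓘(ℝ, E)) =ᶠ[𝓝 (chartOne E G)]
        fun x ↦ chartLeft E G x w := fun w ↦ by
    filter_upwards [(chartAt E (1 : G)).open_target.mem_nhds chartOne_mem_target] with x hx
    exact mpullbackWithin_mulInvariantVectorField hx w
  have hd := ((contDiffAt_chartLeft (E := E) (G := G) chartOne_mem_target).differentiableAt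
    (by simp)).hasFDerivAt
  have hf : ∀ w : E, fderiv ℝ (fun x ↦ chartLeft E G x w) (chartOne E G) =
      (fderiv ℝ (chartLeft E G) (chartOne E G)).flip w := fun w ↦ by
    rw [(hd.clm_apply (hasFDerivAt_const w _)).fderiv]
    ext
    simp
  have key : ∀ (a b : E) (V W : E → E), V =ᶠ[𝓝 (chartOne E G)] (fun x ↦ chartLeft E G x a) →
      W =ᶠ[𝓝 (chartOne E G)] (fun x ↦ chartLeft E G x b) →
      VectorField.lieBracketWithin ℝ V W univ (chartOne E G) =
        fderiv ℝ (chartLeft E G) (chartOne E G) a b -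
          fderiv ℝ (chartLeft E G) (chartOne E G) b a := by
    intro a b V W hV hW
    rw [VectorField.lieBracketWithin_univ, hV.lieBracket_vectorField_eq hW,
      VectorField.lieBracket, hf, hf, chartLeft_chartOne]
    rfl
  simp only [preimage_univ, univ_inter, modelWithCornersSelf_coe, range_id]
  simp only [modelWithCornersSelf_coe, range_id] at hev
  have hid : ∀ w : E, (ContinuousLinearMap.id ℝ E).inverse w = w := fun w ↦ by
    rw [ContinuousLinearMap.inverse_id, ContinuousLinearMap.id_apply]
  exact (hid _).trans (key u v _ _ (hev u) (hev v))

variable [CompleteSpace E]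

/-- Rescaling time by `t` turns an integral curve of `v` into one of `t • v`; uniqueness identifies
the two. Rays in `𝔤` thus map to one-parameter subgroups. -/
theorem lieExp_smul (v : GroupLieAlgebra 𝓘(ℝ, E) G) (t : ℝ) :
    lieExp E G (t • v) = oneParam v t := by
  have h := (oneParam_spec v).comp_mul t
  have e : t • mulInvariantVectorField (I := 𝓘(ℝ, E)) (G := G) v = mulInvariantVectorField (t • v) := by
    ext g
    exact (map_smul (mfderiv 𝓘(ℝ, E) 𝓘(ℝ, E) (g * ·) (1 : G)) t v).symm
  rw [e] at h
  have := congrFun (oneParam_unique (t • v) (by simp [oneParam_zero]) h) 1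
  simpa [lieExp] using this.symm
end LieGroupInChart

/-! ### The differential equation of a Rota--Baxter operator -/

section Operator

variable {E : Type*} [NormedAddCommGroup E] [NormedSpace ℝ E]
  {G : Type*} [TopologicalSpace G] [ChartedSpace E G] [Group G]

variable (G) in
/-- The derivative, read in the chart, of a relative Rota--Baxter operator with differential `D` at
the unit, at a point where it takes the value with coordinates `y`. -/
def rotaBaxterDeriv (D : E →L[ℝ] E) (y : E) : E →L[ℝ] E :=
  ((chartLeft E G y).comp D).comp ((chartLeft E G y).inverse.comp (chartRight E G y))

theorem rotaBaxterDeriv_chartOne (D : E →L[ℝ] E) :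
    rotaBaxterDeriv G D (chartOne E G) = D := by
  rw [rotaBaxterDeriv, chartLeft_chartOne, chartRight_chartOne, ContinuousLinearMap.inverse_id]
  rfl

variable [LieGroup 𝓘(ℝ, E) ∞ G] [CompleteSpace E]

theorem eventually_isInvertible_chartLeft :
    ∀ᶠ y in 𝓝 (chartOne E G), (chartLeft E G y).IsInvertible := by
  have hc := (contDiffAt_chartLeft (E := E) (G := G) chartOne_mem_target).continuousAt
  refine hc.eventually (p := ContinuousLinearMap.IsInvertible) ?_
  rw [chartLeft_chartOne]
  exact ContinuousLinearEquiv.nhds (ContinuousLinearEquiv.refl ℝ E)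

theorem contDiffAt_inverse_chartLeft_comp :
    ContDiffAt ℝ ∞ (fun y ↦ (chartLeft E G y).inverse.comp (chartRight E G y)) (chartOne E G) := by
  have hL := contDiffAt_chartLeft (E := E) (G := G) chartOne_mem_target
  have hi : ContDiffAt ℝ ∞ (fun y ↦ (chartLeft E G y).inverse) (chartOne E G) :=
    ContDiffAt.comp _ (eventually_isInvertible_chartLeft (E := E)
      (G := G)).self_of_nhds.contDiffAt_map_inverse hL
  exact hi.clm_comp (contDiffAt_chartRight chartOne_mem_target)

theorem contDiffAt_rotaBaxterDeriv (D : E →L[ℝ] E) :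
    ContDiffAt ℝ ∞ (rotaBaxterDeriv G D) (chartOne E G) :=
  ((contDiffAt_chartLeft chartOne_mem_target).clm_comp contDiffAt_const).clm_comp
    contDiffAt_inverse_chartLeft_comp

/-- The map `L⁻¹ R` is `Ad` of the inverse, so its derivative at the unit is `-ad`. It is computed
by differentiating `R = L (L⁻¹ R)` and exchanging `dR(u) v` for `dL(v) u`. -/
theorem fderiv_inverse_chartLeft_comp_apply (u v : E) :
    fderiv ℝ (fun y ↦ (chartLeft E G y).inverse.comp (chartRight E G y)) (chartOne E G) u v =
      fderiv ℝ (chartLeft E G) (chartOne E G) v u -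
        fderiv ℝ (chartLeft E G) (chartOne E G) u v := by
  have hL := ((contDiffAt_chartLeft (E := E) (G := G) chartOne_mem_target).differentiableAt
    (by simp)).hasFDerivAt
  have hR := ((contDiffAt_chartRight (E := E) (G := G) chartOne_mem_target).differentiableAt
    (by simp)).hasFDerivAt
  have hA := ((contDiffAt_inverse_chartLeft_comp (E := E) (G := G)).differentiableAt
    (by simp)).hasFDerivAt
  have h := (hL.clm_comp hA).congr_of_eventuallyEq (f₁ := chartRight E G) (by
    filter_upwards [eventually_isInvertible_chartLeft (E := E) (G := G)] with y hy
    rw [← ContinuousLinearMap.comp_assoc, hy.self_comp_inverse, ContinuousLinearMap.id_comp])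
  have e := DFunLike.congr_fun (DFunLike.congr_fun (h.unique hR) u) v
  rw [fderiv_chartRight_apply] at e
  simp [chartLeft_chartOne, chartRight_chartOne] at e
  rw [← e]
  abel

/-- Leibniz rule for `L D (L⁻¹ R)`, where both `L` and `L⁻¹ R` are the identity at the unit. -/
theorem fderiv_rotaBaxterDeriv_apply (D : E →L[ℝ] E) (u v : E) :
    fderiv ℝ (rotaBaxterDeriv G D) (chartOne E G) u v =
      fderiv ℝ (chartLeft E G) (chartOne E G) u (D v) +
        D (fderiv ℝ (chartLeft E G) (chartOne E G) v u -
          fderiv ℝ (chartLeft E G) (chartOne E G) u v) := by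
  have hL := ((contDiffAt_chartLeft (E := E) (G := G) chartOne_mem_target).differentiableAt
    (by simp)).hasFDerivAt
  have hA := ((contDiffAt_inverse_chartLeft_comp (E := E) (G := G)).differentiableAt
    (by simp)).hasFDerivAt
  have h := ((hL.clm_comp (hasFDerivAt_const D _)).clm_comp hA)
  have e := DFunLike.congr_fun (DFunLike.congr_fun h.fderiv u) v
  refine e.trans ?_
  simp [chartLeft_chartOne, chartRight_chartOne, fderiv_inverse_chartLeft_comp_apply]
  abel

/-! ### The operator in exponential coordinates -/

variable {hexp : Function.Bijective (lieExp E G)} {B : ExpGroup hexp → G}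

theorem continuous_oneParam (v : GroupLieAlgebra 𝓘(ℝ, E) G) : Continuous (oneParam v) :=
  continuous_iff_continuousAt.2 fun t ↦ (oneParam_spec v t).continuousAt

/-- Injectivity of `exp` reduces this to cancelling conjugations in `G`. -/
theorem lieAd_lieAd_inv (hexp : Function.Bijective (lieExp E G)) (g : G)
    (v : GroupLieAlgebra 𝓘(ℝ, E) G) :
    lieAd E g (lieAd E g⁻¹ v) = v := by
  apply hexp.injective
  rw [lieExp_lieAd, lieExp_lieAd]
  group

theorem IsRelativeRotaBaxter.apply_exp_mul (hB : IsRelativeRotaBaxter (ExpGroup.Ad hexp) B)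
    (u v : GroupLieAlgebra 𝓘(ℝ, E) G) :
    B (ExpGroup.exp hexp u) * B (ExpGroup.exp hexp v) =
      B (ExpGroup.exp hexp (u + lieAd E (B (ExpGroup.exp hexp u)) v)) := by
  rw [hB]
  congr 1
  change ExpGroup.exp hexp u * ExpGroup.conj hexp _ (ExpGroup.exp hexp v) = _
  rw [ExpGroup.conj_exp, ExpGroup.mul_def, ExpGroup.ln_exp, ExpGroup.ln_exp]

theorem exp_smul (v : GroupLieAlgebra 𝓘(ℝ, E) G) (t : ℝ) :
    ExpGroup.exp hexp (t • v) = ExpGroup.of hexp (oneParam v t) :=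
  congrArg (ExpGroup.of hexp) (lieExp_smul v t)

variable (B) in
/-- The map `𝔤 → G` obtained from `𝓑 : H → G` by composition with the exponential map. -/
def compExp (v : E) : G := B (ExpGroup.exp hexp v)

theorem compExp_zero (hB : IsRelativeRotaBaxter (ExpGroup.Ad hexp) B) : compExp B 0 = 1 := by
  have h : B (1 : ExpGroup hexp) = 1 := hB.map_one
  exact (congrArg B ExpGroup.exp_zero).trans h

/-- Continuity along rays only, which comes from continuity of `B` and of one-parameter subgroups.
Joint continuity near `0` is obtained later from a Lipschitz bound. -/
theorem continuous_compExp_smul (hc : Continuous B) (v : E) :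
    Continuous (fun t : ℝ ↦ compExp B (t • v)) := by
  have e : (fun t : ℝ ↦ compExp B (t • v)) = fun t ↦ B (ExpGroup.of hexp (oneParam (G := G) v t)) :=
    funext fun t ↦ congrArg B (exp_smul v t)
  rw [e]
  exact hc.comp (continuous_oneParam (G := G) v)

theorem hasDerivAt_compExp_smul (hs : ContMDiff 𝓘(ℝ, E) 𝓘(ℝ, E) ∞ B)
    (hB : IsRelativeRotaBaxter (ExpGroup.Ad hexp) B) (v : E) :
    HasDerivAt (fun t : ℝ ↦ chartAt E (1 : G) (compExp B (t • v))) (differentialAtOne B v) 0 := by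
  have e : (fun t : ℝ ↦ compExp B (t • v)) = (B : G → G) ∘ oneParam (G := G) v :=
    funext fun t ↦ congrArg B (exp_smul v t)
  have hb : MDifferentiableAt 𝓘(ℝ, E) 𝓘(ℝ, E) (B : G → G) 1 :=
    (hs.contMDiffAt (x := (1 : ExpGroup hexp))).mdifferentiableAt (by simp)
  have h0 : oneParam (E := E) (G := G) v 0 = 1 := oneParam_zero v
  -- `oneParam v 0` equals `1` only propositionally, so the derivative of `B` is transported along
  -- that equality.
  have hA : ∀ g : G, g = 1 → HasMFDerivAt 𝓘(ℝ, E) 𝓘(ℝ, E) (B : G → G) g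
      (mfderiv 𝓘(ℝ, E) 𝓘(ℝ, E) (B : G → G) 1 : E →L[ℝ] E) := by
    rintro _ rfl
    exact hb.hasMFDerivAt
  have h1B : B (1 : ExpGroup hexp) = 1 := hB.map_one
  have h := (hA _ h0).comp 0 (oneParam_spec (G := G) v 0)
  have hv : (mulInvariantVectorField (I := 𝓘(ℝ, E)) v (oneParam (E := E) (G := G) v 0) : E) = v := by
    rw [h0]
    exact mulInvariantVectorField_one v
  have h1 := hasDerivAt_chart_of_zero (E := E) (G := G) (γ := (B : G → G) ∘ oneParam (G := G) v)
    ((congrArg (B : G → G) h0).trans h1B) h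
  rw [← e] at h1
  have h2 : ∀ (A : E →L[ℝ] E) (w : E), w = v → A ((1 : ℝ) • w) = A v := by
    rintro A w rfl
    rw [one_smul]
  exact (h2 _ _ hv) ▸ h1

/-- The relation moves the line through `x` to a ray through `0`: `f(x + t w) = f(x) f(t v)` with `w
= Ad_{f(x)} v`. Only the derivative along that ray at `t = 0` is then needed. -/
theorem hasLineDerivAt_compExp (hs : ContMDiff 𝓘(ℝ, E) 𝓘(ℝ, E) ∞ B)
    (hB : IsRelativeRotaBaxter (ExpGroup.Ad hexp) B) (D : E →L[ℝ] E)
    (hD : ∀ v : E, D v = differentialAtOne B v) {x : E}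
    (hx : compExp B x ∈ (chartAt E (1 : G)).source)
    (hi : (chartLeft E G (chartAt E (1 : G) (compExp B x))).IsInvertible) (w : E) :
    HasLineDerivAt ℝ (fun y ↦ chartAt E (1 : G) (compExp B y))
      (rotaBaxterDeriv G D (chartAt E (1 : G) (compExp B x)) w) x w := by
  set c := chartAt E (1 : G) with hc
  set g := compExp B x with hg
  obtain ⟨v, hv⟩ : ∃ v : E, lieAd E g v = w := ⟨_, lieAd_lieAd_inv hexp g w⟩
  have hgt := c.map_source hx
  have hRL : chartRight E G (c g) w = chartLeft E G (c g) v := by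
    have := chartRight_lieAd hgt v
    rwa [c.left_inv hx, hv] at this
  have hK : rotaBaxterDeriv G D (c g) w = chartLeft E G (c g) (D v) := by
    -- As `R w = L v`, invertibility of `L` gives `L⁻¹ R w = v`.
    simp only [rotaBaxterDeriv, ContinuousLinearMap.comp_apply, hRL, hi.inverse_apply_self]
  have hmul : ∀ t : ℝ, compExp B (x + t • w) = g * compExp B (t • v) := fun t ↦ by
    refine ((hB.apply_exp_mul x (t • v)).trans ?_).symm
    refine congrArg (compExp B) (congrArg (x + ·) ?_)
    rw [← hv]
    exact map_smul (lieAd E g) t v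
  have h1 := hasDerivAt_compExp_smul hs hB v
  have hz : c (compExp B ((0 : ℝ) • v)) = chartOne E G := by
    rw [zero_smul, compExp_zero hB]
    rfl
  have hev : ∀ᶠ t : ℝ in 𝓝 0, compExp B (t • v) ∈ c.source := by
    refine (continuous_compExp_smul hs.continuous v).continuousAt (c.open_source.mem_nhds ?_)
    rw [zero_smul, compExp_zero hB]
    exact mem_chart_source E (1 : G)
  have h2 := HasFDerivAt.comp_hasDerivAt (0 : ℝ) (hz.symm ▸ hasFDerivAt_chartMul_left hgt) h1
  rw [hK, hD]
  refine h2.congr_of_eventuallyEq ?_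
  filter_upwards [hev] with t ht
  simp only [hmul, Function.comp_apply, chartMul]
  rw [c.left_inv hx, c.left_inv ht]

variable [FiniteDimensional ℝ E]

/-- A smooth relative Rota--Baxter operator, composed with the exponential map, is differentiable
near `0`. -/
theorem eventually_hasFDerivAt_compExp (hs : ContMDiff 𝓘(ℝ, E) 𝓘(ℝ, E) ∞ B)
    (hB : IsRelativeRotaBaxter (ExpGroup.Ad hexp) B) (D : E →L[ℝ] E)
    (hD : ∀ v : E, D v = differentialAtOne B v) :
    ∀ᶠ x in 𝓝 (0 : E), HasFDerivAt (fun y ↦ chartAt E (1 : G) (compExp B y))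
      (rotaBaxterDeriv G D (chartAt E (1 : G) (compExp B x))) x := by
  have := t2Space E G
  set c := chartAt E (1 : G) with hc
  have hK := contDiffAt_rotaBaxterDeriv (G := G) D
  -- The added `1` makes `C` positive and the norm bound strict, hence stable near the unit.
  set C := ‖rotaBaxterDeriv G D (chartOne E G)‖ + 1 with hC
  have hC0 : 0 < C := by positivity
  have hKc : ∀ᶠ y in 𝓝 (chartOne E G), ContinuousAt (rotaBaxterDeriv G D) y := by
    have h1 : ContDiffAt ℝ 1 (rotaBaxterDeriv G D) (chartOne E G) := hK.of_le (by simp)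
    filter_upwards [h1.eventually (by simp)] with y hy using hy.continuousAt
  have hKb : ∀ᶠ y in 𝓝 (chartOne E G), ‖rotaBaxterDeriv G D y‖ < C :=
    hK.continuousAt.norm.eventually (gt_mem_nhds (lt_add_one _))
  have ht : ∀ᶠ y in 𝓝 (chartOne E G), y ∈ c.target :=
    c.open_target.mem_nhds chartOne_mem_target
  obtain ⟨r, hr, hball⟩ := Metric.eventually_nhds_iff_ball.1
    ((ht.and eventually_isInvertible_chartLeft).and (hKc.and hKb))
  have hline : ∀ x : E, compExp B x ∈ c.source → c (compExp B x) ∈ Metric.ball (chartOne E G) r →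
      ∀ w, HasLineDerivAt ℝ (fun y ↦ c (compExp B y))
        (rotaBaxterDeriv G D (c (compExp B x)) w) x w :=
    fun x hx hx' w ↦ hasLineDerivAt_compExp hs hB D hD hx (hball _ hx').1.2 w
  have hbound : ∀ y ∈ Metric.ball (chartOne E G) r, ∀ w, ‖rotaBaxterDeriv G D y w‖ ≤ C * ‖w‖ :=
    fun y hy w ↦ ContinuousLinearMap.le_of_opNorm_le _ (hball y hy).2.2.le w
  -- The curve `t ↦ f(t x)` has speed at most `C ‖x‖`, which is less than `r` for `‖x‖ < r / C`, so
  -- it stays in the chart ball up to time `1`.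
  have hstay : ∀ x ∈ Metric.ball (0 : E) (r / C),
      compExp B x ∈ c.source ∧ c (compExp B x) ∈ Metric.ball (chartOne E G) r := by
    intro x hx
    rw [mem_ball_zero_iff, lt_div_iff₀ hC0, mul_comm] at hx
    have h := mem_source_of_speed_le c (mem_chart_source E (1 : G)) hr
      (fun y hy ↦ (hball y hy).1.1) (continuous_compExp_smul hs.continuous x)
      (by simp only [zero_smul, compExp_zero hB])
      (γ' := fun t ↦ rotaBaxterDeriv G D (c (compExp B (t • x))) x) hx
      (fun t ht ht' ↦ ⟨?_, hbound _ ht' x⟩) (right_mem_Icc.2 zero_le_one)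
    · rw [one_smul] at h
      exact h
    · have h0 : HasDerivAt (fun s : ℝ ↦ c (compExp B (t • x + s • x)))
          (rotaBaxterDeriv G D (c (compExp B (t • x))) x) (t - t) := by
        rw [sub_self]
        exact hline _ ht ht' x
      refine (h0.comp_sub_const t t).congr_of_eventuallyEq (.of_forall fun s ↦ ?_)
      simp only [Function.comp_apply, ← add_smul, add_sub_cancel]
  -- Uniformly bounded line derivatives on a convex ball give a Lipschitz bound, the first
  -- continuity of `f` not confined to lines.
  have hlip : ∀ x ∈ Metric.ball (0 : E) (r / C), ContinuousAt (fun y ↦ c (compExp B y)) x := by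
    have hL : LipschitzOnWith C.toNNReal (fun y ↦ c (compExp B y)) (Metric.ball (0 : E) (r / C)) :=
      LipschitzOnWith.of_dist_le_mul fun y hy x hx ↦ by
        rw [dist_eq_norm, dist_eq_norm, Real.coe_toNNReal _ hC0.le]
        exact norm_sub_le_of_hasLineDerivAt (convex_ball _ _)
          (fun z hz ↦ hline z (hstay z hz).1 (hstay z hz).2)
          (fun z hz ↦ hbound _ (hstay z hz).2) hx hy
    exact fun x hx ↦ hL.continuousOn.continuousAt (Metric.isOpen_ball.mem_nhds hx)
  filter_upwards [Metric.ball_mem_nhds (0 : E) (div_pos hr hC0)] with x hx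
  refine hasFDerivAt_of_hasLineDerivAt
    (f' := fun z ↦ rotaBaxterDeriv G D (c (compExp B z))) ?_ ?_
  · filter_upwards [Metric.isOpen_ball.mem_nhds hx] with z hz using
      hline z (hstay z hz).1 (hstay z hz).2
  · exact ContinuousAt.comp (f := fun z ↦ c (compExp B z)) (hball _ (hstay x hx).2).2.1 (hlip x hx)

end Operator

end RB

end

/-! ### The integrability condition at the origin -/

theorem mainTheorem9 {E : Type*} [NormedAddCommGroup E] [NormedSpace ℝ E] [FiniteDimensional ℝ E]
    [CompleteSpace E]
    {G : Type*} [TopologicalSpace G] [ChartedSpace E G] [Group G] [LieGroup 𝓘(ℝ, E) ∞ G]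
    (hexp : Function.Bijective (RB.lieExp E G))
    (B : RB.ExpGroup hexp → G) (hB_smooth : ContMDiff 𝓘(ℝ, E) 𝓘(ℝ, E) ∞ B)
    (hB : RB.IsRelativeRotaBaxter (RB.ExpGroup.Ad hexp) B) :
    RB.IsLieRotaBaxter (0 : ℝ) (RB.differentialAtOne B) := by
  intro u v
  obtain ⟨D, hD⟩ : ∃ D : E →L[ℝ] E, ∀ w : E, D w = RB.differentialAtOne B w :=
    ⟨mfderiv 𝓘(ℝ, E) 𝓘(ℝ, E) B (1 : RB.ExpGroup hexp), fun _ ↦ rfl⟩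
  have hf := RB.eventually_hasFDerivAt_compExp hB_smooth hB D hD
  have h0 : chartAt E (1 : G) (RB.compExp B 0) = RB.chartOne E G := by
    rw [RB.compExp_zero hB]
    rfl
  have hK := ((RB.contDiffAt_rotaBaxterDeriv (G := G) D).differentiableAt (by simp)).hasFDerivAt
  have hf0 := hf.self_of_nhds
  rw [h0, RB.rotaBaxterDeriv_chartOne] at hf0
  -- Differentiating `df_x = K(f(x))` once more at `0`, where `df_0 = D`, gives the second
  -- derivative of `f`.
  have hx : HasFDerivAt (fun x ↦ RB.rotaBaxterDeriv G D (chartAt E (1 : G) (RB.compExp B x)))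
      ((fderiv ℝ (RB.rotaBaxterDeriv G D) (RB.chartOne E G)).comp D) 0 :=
    HasFDerivAt.comp (g := RB.rotaBaxterDeriv G D) (0 : E) (h0.symm ▸ hK) hf0
  have hsymm := second_derivative_symmetric_of_eventually_of_real hf hx
  -- The symmetry `dK(D a) b = dK(D b) a` written out; the terms regroup into the three brackets of
  -- the Rota--Baxter identity.
  have key : ∀ a b : E, fderiv ℝ (RB.chartLeft E G) (RB.chartOne E G) (D a) (D b) -
      fderiv ℝ (RB.chartLeft E G) (RB.chartOne E G) (D b) (D a) =
      D ((fderiv ℝ (RB.chartLeft E G) (RB.chartOne E G) (D a) b -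
        fderiv ℝ (RB.chartLeft E G) (RB.chartOne E G) b (D a)) +
        (fderiv ℝ (RB.chartLeft E G) (RB.chartOne E G) a (D b) -
        fderiv ℝ (RB.chartLeft E G) (RB.chartOne E G) (D b) a)) := by
    intro a b
    have h := hsymm a b
    rw [ContinuousLinearMap.comp_apply, ContinuousLinearMap.comp_apply,
      RB.fderiv_rotaBaxterDeriv_apply, RB.fderiv_rotaBaxterDeriv_apply] at h
    simp only [map_add, map_sub] at h ⊢
    rw [sub_eq_iff_eq_add, ← sub_eq_zero]
    rw [← sub_eq_zero] at h
    rw [← h]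
    abel
  rw [zero_smul, add_zero, RB.bracket_eq_chartLeft, RB.bracket_eq_chartLeft,
    RB.bracket_eq_chartLeft]
  exact hD u ▸ hD v ▸ (key u v).trans (hD _)
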